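/- **Theorem 4.1.** A subset $S$ of a compact Hausdorff space $K$ is a *$\Sigma$-subset* if $S=\varphi^{-1}[\Sigma(\Gamma)]$ for some index set $\Gamma$ and some continuous injection $\varphi:K\to\mathbb R^\Gamma$ (product topology), where $\Sigma(\Gamma)$ is the set of $x\in\mathbb R^\Gamma$ such that $\{\gamma\in\Gamma: x_\gamma\neq 0\}$ is countable. A *Valdivia compact space* is a compact Hausdorff space that admits a dense $\Sigma$-subset. Assume $\diamondsuit$, i.e. there is a family $(A_\alpha)_{\alpha<\omega_1}$ with $A_\alpha\subset\alpha$ such that, for every $X\subset\omega_1$, the set $\{\alpha<\omega_1: X\cap\alpha=A_\alpha\}$ is stationary in $\omega_1$. Then there exists a Valdivia compact space $K$ such that: (a) the weight of $K$ (the least cardinality of a base) is $\omega_1$; (b) $K$ satisfies the countable chain condition (ccc): every family of pairwise disjoint nonempty open subsets of $K$ is countable; (c) $K$ has no $G_\delta$ points, i.e. $\{x\}$ is not a $G_\delta$ subset of $K$ for any $x\in K$; (d) for every dense $\Sigma$-subset $S$ of $K$, the complement $K\setminus S$ contains no nontrivial convergent sequence: every sequence in $K\setminus S$ that converges to a point of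 $K\setminus S$ is eventually constant. Consequently (under $\diamondsuit$) the following conjecture is false: every nonempty Valdivia compact space satisfying ccc either has a $G_\delta$ point or admits a nontrivial convergent sequence in the complement of a dense $\Sigma$-subset. -/

import Mathlib

open Filter Topology
open scoped Cardinal Ordinal

/-- `A` is a diamond sequence on `ω₁` (the type of ordinals below `ω₁`): `A α ⊆ α` for every
`α < ω₁`, and for every `X ⊆ ω₁` the set of `α < ω₁` with `X ∩ α = A α` is stationary in `ω₁`. -/
def IsDiamondSequence (A : Set.Iio (ω₁ : Ordinal.{0}) → Set (Set.Iio (ω₁ : Ordinal.{0}))) : Prop :=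
  (∀ α, A α ⊆ Set.Iio α) ∧
    ∀ X : Set (Set.Iio (ω₁ : Ordinal.{0})), IsStationary {α | X ∩ Set.Iio α = A α}

/-- Jensen's combinatorial principle diamond on `ω₁`. -/
def Diamond : Prop :=
  ∃ A : Set.Iio (ω₁ : Ordinal.{0}) → Set (Set.Iio (ω₁ : Ordinal.{0})), IsDiamondSequence A

universe u

/-- The set `Σ(Γ)` of points of `ℝ^Γ` with countable support. -/
def SigmaProduct (Γ : Type u) : Set (Γ → ℝ) :=
  {x | {γ | x γ ≠ 0}.Countable}

/-- `S` is a Σ-subset of `K`: the preimage of `Σ(Γ)` under a continuous injection of `K` into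
`ℝ^Γ` (with the product topology), for some index set `Γ`. Index sets in the universe of `K` are
enough: one may identify equal coordinates, up to `ω₁` repetitions of each. -/
def IsSigmaSubset {K : Type u} [TopologicalSpace K] (S : Set K) : Prop :=
  ∃ (Γ : Type u) (φ : K → Γ → ℝ),
    Continuous φ ∧ Function.Injective φ ∧ S = φ ⁻¹' SigmaProduct Γ

/-- A Valdivia compactum: a compact Hausdorff space admitting a dense Σ-subset. -/
structure IsValdiviaCompact (K : Type u) [TopologicalSpace K] : Prop where
  compactSpace : CompactSpace K
  t2Space : T2Space K
  exists_dense_sigmaSubset : ∃ S : Set K, IsSigmaSubset S ∧ Dense S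

/-- The weight of a topological space: the least cardinality of a base. -/
noncomputable def topWeight (K : Type u) [TopologicalSpace K] : Cardinal.{u} :=
  sInf {κ | ∃ B : Set (Set K), TopologicalSpace.IsTopologicalBasis B ∧ #B = κ}

/-- The countable chain condition: every family of pairwise disjoint nonempty open sets is
countable. -/
def HasCCC (K : Type u) [TopologicalSpace K] : Prop :=
  ∀ 𝒰 : Set (Set K), (∀ U ∈ 𝒰, IsOpen U ∧ U.Nonempty) → 𝒰.PairwiseDisjoint id → 𝒰.Countable

/-- Some point `x` of `K` is a `G_δ` point, i.e. `{x}` is a `G_δ` subset of `K`. -/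
def HasGδPoint (K : Type u) [TopologicalSpace K] : Prop :=
  ∃ x : K, IsGδ ({x} : Set K)

/-- The subspace `C` contains a nontrivial convergent sequence: a sequence of points of `C` that
converges to a point of `C` and is not eventually equal to its limit. -/
def HasNontrivialConvergentSeq {K : Type u} [TopologicalSpace K] (C : Set K) : Prop :=
  ∃ (s : ℕ → K) (x : K), (∀ n, s n ∈ C) ∧ x ∈ C ∧ Tendsto s atTop (𝓝 x) ∧
    ¬ ∀ᶠ n in atTop, s n = x

/-- `K` admits a nontrivial convergent sequence in the complement of some dense Σ-subset. -/
def HasSeqOutsideDenseSigma (K : Type u) [TopologicalSpace K] : Prop :=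
  ∃ S : Set K, IsSigmaSubset S ∧ Dense S ∧ HasNontrivialConvergentSeq Sᶜ

/-- The conjecture on Valdivia compacta: a nonempty Valdivia compactum satisfying ccc either has a
`G_δ` point or admits a nontrivial convergent sequence in the complement of a dense Σ-subset. -/
def ValdiviaConjecture : Prop :=
  ∀ (K : Type) [TopologicalSpace K], Nonempty K → IsValdiviaCompact K → HasCCC K →
    HasGδPoint K ∨ HasSeqOutsideDenseSigma K

/-!
The space is built in two stages inside Cantor cubes indexed by `I = ω₁`.

Points `p = (x, v)` of `(Bool × Bool) ^ I` are subjected to one constraint for each `α`. Diamond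
supplies at each `α` a guess `d α` of a sequence of points restricted to `α`. If the guess is a
nontrivial sequence of points satisfying the earlier constraints and converges below `α` to some
`y`, the constraint at `α` demands `v α = g (p ↾ α)` whenever `p ↾ α ≠ y ↾ α`, where `g` is
locally constant off `y` and takes both values infinitely often along the guess
(`IsNontrivialSeqBelow.exists_oscillating`, `exists_isConstraint`); otherwise it demands `v α = 0`.
The set of points satisfying all constraints is compact, and it contains no nontrivial convergent
sequence: such a sequence would be guessed at some `α` where it is already nontrivial, and its bits
`v α` would oscillate (`IsConstraintFamily.eventually_eq`). On the other hand `x` is entirely free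
(`IsConstraintFamily.exists_extension`), and the projection `(x, v) ↦ x` is irreducible, because
over `y` both values of `v α` are approximated by nearby points of the guess
(`IsConstraintFamily.exists_isOpen_below`).

Such a space is far from Valdivia. The compactum `K` is its image under `gate`, which keeps `x` but
shows `v α` only through the products `x β * v α` with `β ≥ α`. The points whose `x` has countable
support now form a dense Σ-subset `S`. At a point outside `S` all of `v` is visible, so
convergence in `K` to that point implies convergence upstairs, and no nontrivial sequence converges
to it (`IsConstraintFamily.eventually_eq_of_tendsto_gatedSpace`). As Σ-subsets are
Fréchet–Urysohn and `K` has no isolated points, this also forces every dense Σ-subset to equal `S`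
(`IsSigmaSubset.eq_of_dense`). The freedom of `x` gives the density of `S` and the absence of `G_δ`
points; irreducibility of the projection to the separable cube `Bool ^ I` gives the countable chain
condition. The weight is at most `ℵ₁` by the number of coordinates, and uncountable because
points of a Hausdorff space of countable weight are `G_δ`.
-/

/-! ### The diamond principle as a guessing principle -/

/-- If initial segments are countable and countable sets are bounded, the points of a well-order
that lie above `δ` and are closed under `f` form a club. -/
theorem isClub_closurePoints {J : Type*} [LinearOrder J] [WellFoundedLT J]
    (hc : ∀ a : J, (Set.Iio a).Countable)
    (hb : ∀ s : Set J, s.Countable → ∃ b, ∀ a ∈ s, a < b) (f : J → J) (δ : J) :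
    IsClub {α : J | δ < α ∧ ∀ γ < α, f γ < α} := by
  refine ⟨?_, ?_⟩
  · intro d hd hne _ a ha
    obtain ⟨x, hx⟩ := hne
    refine ⟨(hd hx).1.trans_le (ha.1 hx), fun γ hγ => ?_⟩
    obtain ⟨z, hz, hγz⟩ := (lt_isLUB_iff ha).1 hγ
    exact ((hd hz).2 γ hγz).trans_le (ha.1 hz)
  · intro a
    -- A closure point above `a` is the supremum of iterates of a function dominating `f`.
    have step : ∀ b : J, ∃ b', b < b' ∧ ∀ γ ≤ b, f γ < b' := by
      intro b
      have hcb : (Set.Iic b).Countable := by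
        rw [← Set.Iio_insert]; exact (hc b).insert b
      obtain ⟨b', hb'⟩ := hb (insert b (f '' Set.Iic b)) ((hcb.image f).insert b)
      exact ⟨b', hb' b (Set.mem_insert _ _),
        fun γ hγ => hb' _ (Set.mem_insert_of_mem _ ⟨γ, hγ, rfl⟩)⟩
    choose nx hnx hnf using step
    let b : ℕ → J := fun n => nx^[n] (max a δ)
    have hbs : ∀ n, b (n + 1) = nx (b n) := fun n => Function.iterate_succ_apply' nx n _
    have hex : ∃ c, ∀ n, b n < c := by
      obtain ⟨c, hc'⟩ := hb (Set.range b) (Set.countable_range b)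
      exact ⟨c, fun n => hc' _ ⟨n, rfl⟩⟩
    let α := wellFounded_lt.min {c | ∀ n, b n < c} hex
    have hα : ∀ n, b n < α := wellFounded_lt.min_mem {c | ∀ n, b n < c} hex
    have hmin : ∀ γ < α, ∃ n, γ ≤ b n := by
      intro γ hγ
      by_contra! h
      exact wellFounded_lt.not_lt_min {c | ∀ n, b n < c} h hγ
    refine ⟨α, ⟨(le_max_right a δ).trans_lt (hα 0), fun γ hγ => ?_⟩,
      (le_max_left a δ).trans (hα 0).le⟩
    obtain ⟨n, hn⟩ := hmin γ hγ
    have h1 := hnf (b n) γ hn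
    rw [← hbs] at h1
    exact h1.trans (hα _)

theorem countable_Iio_of_omega_one (a : Set.Iio (ω₁ : Ordinal.{0})) : (Set.Iio a).Countable := by
  have h : (Set.Iio (a : Ordinal.{0})).Countable := by
    rw [← Cardinal.le_aleph0_iff_set_countable, Cardinal.mk_Iio_ordinal,
      Cardinal.lift_le_aleph0, ← Cardinal.lt_aleph_one_iff]
    have h2 : (a : Ordinal.{0}) < (ℵ₁).ord := by
      rw [Cardinal.ord_aleph]; exact a.2
    exact Cardinal.lt_ord.1 h2
  refine (h.preimage Subtype.val_injective).mono ?_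
  intro x hx
  exact hx

theorem exists_bound_of_countable_omega_one (s : Set (Set.Iio (ω₁ : Ordinal.{0})))
    (hs : s.Countable) : ∃ b, ∀ a ∈ s, a < b := by
  have : Countable s := hs.to_subtype
  have hsucc : ∀ i : s, Order.succ ((i : Set.Iio (ω₁ : Ordinal.{0})) : Ordinal.{0}) < ω₁ :=
    fun i => (Cardinal.isSuccLimit_omega 1).succ_lt i.1.2
  refine ⟨⟨⨆ i : s, Order.succ ((i : Set.Iio (ω₁ : Ordinal.{0})) : Ordinal.{0}),
    Ordinal.iSup_lt_omega_one hsucc⟩, fun a ha => ?_⟩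
  have hbdd : BddAbove (Set.range fun i : s =>
      Order.succ ((i : Set.Iio (ω₁ : Ordinal.{0})) : Ordinal.{0})) :=
    ⟨ω₁, by rintro _ ⟨i, rfl⟩; exact (hsucc i).le⟩
  exact (Order.lt_succ (a : Ordinal.{0})).trans_le (le_ciSup hbdd ⟨a, ha⟩)

/-- Consequence of diamond, transported to a well-order of type `ω₁` living in `Type`: some
sequence of sets guesses every `X` at some `α` above `δ` that is closed under `f`. -/
theorem Diamond.exists_guess (h : Diamond) :
    ∃ A : (ω₁ : Ordinal.{0}).ToType → Set (ω₁ : Ordinal.{0}).ToType,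
      ∀ (X : Set (ω₁ : Ordinal.{0}).ToType) (f : (ω₁ : Ordinal.{0}).ToType →
        (ω₁ : Ordinal.{0}).ToType) (δ : (ω₁ : Ordinal.{0}).ToType),
        ∃ α, δ < α ∧ (∀ γ < α, f γ < α) ∧ ∀ γ < α, (γ ∈ X ↔ γ ∈ A α) := by
  obtain ⟨A, -, hA⟩ := h
  let e : Set.Iio (ω₁ : Ordinal.{0}) ≃o (ω₁ : Ordinal.{0}).ToType := Ordinal.ToType.mk
  refine ⟨fun α => e.symm ⁻¹' A (e.symm α), fun X f δ => ?_⟩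
  obtain ⟨α, hα, hδ, hf⟩ := hA (e ⁻¹' X) (isClub_closurePoints countable_Iio_of_omega_one
    exists_bound_of_countable_omega_one (fun γ => e.symm (f (e γ))) (e.symm δ))
  refine ⟨e α, ?_, fun γ hγ => ?_, fun γ hγ => ?_⟩
  · exact e.symm_apply_lt.1 hδ
  · have := hf (e.symm γ) (e.symm_apply_lt.2 hγ)
    simpa using e.symm_apply_lt.1 this
  · have hα' : (e ⁻¹' X) ∩ Set.Iio α = A α := hα
    have h2 : e.symm γ < α := e.symm_apply_lt.2 hγ
    simp only [Set.mem_preimage, OrderIso.symm_apply_apply]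
    rw [← hα']
    simp [h2]

theorem countable_Iio_toType_omega_one (a : (ω₁ : Ordinal.{0}).ToType) :
    (Set.Iio a).Countable := by
  let e : Set.Iio (ω₁ : Ordinal.{0}) ≃o (ω₁ : Ordinal.{0}).ToType := Ordinal.ToType.mk
  have := (countable_Iio_of_omega_one (e.symm a)).preimage e.symm.injective
  refine this.mono fun x hx => ?_
  exact e.symm.lt_iff_lt.2 hx

theorem exists_bound_of_countable_toType_omega_one (s : Set (ω₁ : Ordinal.{0}).ToType)
    (hs : s.Countable) : ∃ b, ∀ a ∈ s, a < b := by
  let e : Set.Iio (ω₁ : Ordinal.{0}) ≃o (ω₁ : Ordinal.{0}).ToType := Ordinal.ToType.mk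
  obtain ⟨b, hb⟩ := exists_bound_of_countable_omega_one (e ⁻¹' s) (hs.preimage e.injective)
  refine ⟨e b, fun a ha => ?_⟩
  exact e.symm_apply_lt.1 (hb (e.symm a) (by simpa using ha))

theorem mk_toType_omega_one : #(ω₁ : Ordinal.{0}).ToType = ℵ₁ := by
  simp

/-! ### Σ-subsets are Fréchet–Urysohn -/

/-- Noble's theorem: points of `Σ(Γ)` in the closure of a subset of `Σ(Γ)` are limits of
sequences from that subset. The terms of the sequence are chosen so that the `n`-th one is close
to `x` on finitely many coordinates of the supports of `x` and of its predecessors; off all these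
supports everything vanishes. -/
theorem exists_seq_tendsto_of_sigmaProduct {Γ : Type*} {A : Set (Γ → ℝ)} {x : Γ → ℝ}
    (hA : ∀ a ∈ A, {γ | a γ ≠ 0}.Countable) (hx : {γ | x γ ≠ 0}.Countable)
    (hxA : x ∈ closure A) : ∃ s : ℕ → Γ → ℝ, (∀ n, s n ∈ A) ∧ Tendsto s atTop (𝓝 x) := by
  rcases isEmpty_or_nonempty Γ with hΓ | ⟨⟨γ₀⟩⟩
  · obtain ⟨a, ha⟩ := closure_nonempty_iff.1 ⟨x, hxA⟩
    exact ⟨fun _ => a, fun _ => ha, by rw [Subsingleton.elim x a]; exact tendsto_const_nhds⟩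
  have hE : ∀ a : Γ → ℝ, ∃ E : ℕ → Γ, {γ | a γ ≠ 0}.Countable → {γ | a γ ≠ 0} ⊆ Set.range E := by
    intro a
    by_cases h : {γ | a γ ≠ 0}.Countable
    · obtain ⟨E, hE⟩ := (h.insert γ₀).exists_eq_range ⟨γ₀, Set.mem_insert _ _⟩
      exact ⟨E, fun _ => hE ▸ Set.subset_insert _ _⟩
    · exact ⟨fun _ => γ₀, fun h' => absurd h' h⟩
  choose E hE using hE
  have approx : ∀ (F : Finset Γ) (ε : ℝ), 0 < ε → ∃ a ∈ A, ∀ γ ∈ F, |a γ - x γ| < ε := by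
    intro F ε hε
    have hU : IsOpen {a : Γ → ℝ | ∀ γ ∈ F, |a γ - x γ| < ε} := by
      have : {a : Γ → ℝ | ∀ γ ∈ F, |a γ - x γ| < ε}
          = ⋂ γ ∈ F, {a : Γ → ℝ | |a γ - x γ| < ε} := by ext; simp
      rw [this]
      exact isOpen_biInter_finset fun γ _ => isOpen_lt (by fun_prop) continuous_const
    obtain ⟨a, haU, haA⟩ := mem_closure_iff.1 hxA _ hU (by simp [hε])
    exact ⟨a, haA, haU⟩
  obtain ⟨f, hf, hfr⟩ := exists_seq_of_forall_finset_exists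
    (fun q : (Γ → ℝ) × ℕ => q.1 ∈ A ∧ ∀ k ≤ q.2, |q.1 (E x k) - x (E x k)| < 1 / ((q.2 : ℝ) + 1))
    (fun q q' => q.2 < q'.2 ∧
      ∀ k ≤ q'.2, |q'.1 (E q.1 k) - x (E q.1 k)| < 1 / ((q'.2 : ℝ) + 1)) (by
    classical
    intro s _
    let n := s.sup Prod.snd + 1
    obtain ⟨a, ha, ha'⟩ := approx
      ((insert x (s.image Prod.fst)).biUnion fun b => (Finset.range (n + 1)).image (E b))
      (1 / ((n : ℝ) + 1)) (by positivity)
    refine ⟨(a, n), ⟨ha, fun k hk => ha' _ ?_⟩, fun q hq => ⟨?_, fun k hk => ha' _ ?_⟩⟩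
    · simp only [Finset.mem_biUnion, Finset.mem_image, Finset.mem_range]
      exact ⟨x, Finset.mem_insert_self _ _, k, by simp at hk; omega, rfl⟩
    · exact Nat.lt_succ_of_le (Finset.le_sup (f := Prod.snd) hq)
    · simp only [Finset.mem_biUnion, Finset.mem_image, Finset.mem_range]
      exact ⟨q.1, Finset.mem_insert_of_mem (Finset.mem_image_of_mem _ hq), k,
        by simp at hk; omega, rfl⟩)
  have hmono : StrictMono fun n => (f n).2 := fun m n hmn => (hfr m n hmn).1
  have hlim : Tendsto (fun n => 1 / (((f n).2 : ℝ) + 1)) atTop (𝓝 0) :=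
    tendsto_one_div_add_atTop_nhds_zero_nat.comp hmono.tendsto_atTop
  refine ⟨fun n => (f n).1, fun n => (hf n).1, tendsto_pi_nhds.2 fun γ => ?_⟩
  have key : (∀ᶠ n in atTop, |(f n).1 γ - x γ| < 1 / (((f n).2 : ℝ) + 1)) →
      Tendsto (fun n => (f n).1 γ) atTop (𝓝 (x γ)) := by
    intro h
    rw [tendsto_iff_dist_tendsto_zero]
    exact squeeze_zero' (Eventually.of_forall fun _ => dist_nonneg)
      (h.mono fun n hn => by rw [Real.dist_eq]; exact hn.le) hlim
  by_cases h0 : x γ = 0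
  · by_cases h1 : ∃ m, (f m).1 γ ≠ 0
    · obtain ⟨m, hm⟩ := h1
      obtain ⟨k, rfl⟩ := hE (f m).1 (hA _ (hf m).1) hm
      refine key ?_
      filter_upwards [eventually_gt_atTop m, hmono.tendsto_atTop.eventually_ge_atTop k]
        with n hn hk
      exact (hfr m n hn).2 k hk
    · push Not at h1
      simp only [h1, h0]
      exact tendsto_const_nhds
  · obtain ⟨k, rfl⟩ := hE x hx h0
    refine key ?_
    filter_upwards [hmono.tendsto_atTop.eventually_ge_atTop k] with n hk
    exact (hf n).2 k hk

section SigmaSubset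

variable {K : Type u} [TopologicalSpace K]

theorem IsSigmaSubset.exists_seq_tendsto [CompactSpace K] {S A : Set K} {x : K}
    (hS : IsSigmaSubset S) (hA : A ⊆ S) (hx : x ∈ S) (hxA : x ∈ closure A) :
    ∃ s : ℕ → K, (∀ n, s n ∈ A) ∧ Tendsto s atTop (𝓝 x) := by
  obtain ⟨Γ, φ, hφ, hinj, rfl⟩ := hS
  have hemb := hφ.isClosedEmbedding hinj
  obtain ⟨s, hs, hlim⟩ := exists_seq_tendsto_of_sigmaProduct (A := φ '' A) (x := φ x)
    (by rintro _ ⟨a, ha, rfl⟩; exact hA ha) hx (image_closure_subset_closure_image hφ ⟨x, hxA, rfl⟩)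
  choose t ht hts using hs
  refine ⟨t, ht, hemb.isInducing.tendsto_nhds_iff.2 ?_⟩
  simpa [Function.comp_def, hts] using hlim

theorem IsSigmaSubset.mem_of_tendsto {S : Set K} (hS : IsSigmaSubset S) {s : ℕ → K} {x : K}
    (hs : ∀ n, s n ∈ S) (hx : Tendsto s atTop (𝓝 x)) : x ∈ S := by
  obtain ⟨Γ, φ, hφ, -, rfl⟩ := hS
  have hcount : (⋃ n, {γ | φ (s n) γ ≠ 0}).Countable := Set.countable_iUnion hs
  refine hcount.mono fun γ hγ => ?_
  by_contra hn
  have h0 : ∀ n, φ (s n) γ = 0 := by simpa using hn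
  have hlim := ((continuous_apply γ).comp hφ).tendsto x |>.comp hx
  simp only [Function.comp_def, h0] at hlim
  exact hγ (tendsto_nhds_unique hlim tendsto_const_nhds)

/-- If no nontrivial sequence converges to a point outside the dense Σ-subset `S` and no point is
isolated, then `S` is the only dense Σ-subset: a point of another one, `T`, lying outside `S` would
be the limit of a nontrivial sequence in `T`. -/
theorem IsSigmaSubset.eq_of_dense [CompactSpace K] {S T : Set K}
    (hS : IsSigmaSubset S) (hT : IsSigmaSubset T) (hTd : Dense T)
    (hiso : ∀ x : K, ¬ IsOpen ({x} : Set K))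
    (hseq : ∀ (s : ℕ → K) (x : K), x ∉ S → Tendsto s atTop (𝓝 x) → ∀ᶠ n in atTop, s n = x) :
    T = S := by
  have hTS : T ⊆ S := by
    intro t ht
    by_contra htS
    have hcl : t ∈ closure (T \ {t}) := by
      rw [mem_closure_iff]
      intro U hU htU
      by_contra hemp
      have hUt : U \ closure {t} = ∅ := by
        have ho : IsOpen (U \ closure {t}) := hU.sdiff isClosed_closure
        by_contra hne
        obtain ⟨y, hy, hyT⟩ := hTd.inter_open_nonempty _ ho (Set.nonempty_iff_ne_empty.2 hne)
        exact hemp ⟨y, hy.1, hyT, fun h => hy.2 (subset_closure h)⟩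
      obtain ⟨Γ, φ, hφ, hinj, -⟩ := hT
      have : T2Space K := T2Space.of_injective_continuous hinj hφ
      rw [closure_singleton, Set.sdiff_eq_empty] at hUt
      exact hiso t (by rwa [← Set.Subset.antisymm hUt (Set.singleton_subset_iff.2 htU)])
    obtain ⟨s, hs, hlim⟩ := hT.exists_seq_tendsto Set.sdiff_subset ht hcl
    obtain ⟨n, hn⟩ := (hseq s t htS hlim).exists
    exact (hs n).2 hn
  refine hTS.antisymm fun x hx => ?_
  obtain ⟨s, hs, hlim⟩ := hS.exists_seq_tendsto hTS hx (hTd x)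
  exact hT.mem_of_tendsto hs hlim

end SigmaSubset

/-! ### Cantor cubes -/

/-- Basic neighbourhoods in a product of discrete spaces. -/
theorem isOpen_iff_finset_agree {ι β : Type*} [TopologicalSpace β] [DiscreteTopology β]
    {U : Set (ι → β)} :
    IsOpen U ↔ ∀ p ∈ U, ∃ F : Finset ι, ∀ q, (∀ i ∈ F, q i = p i) → q ∈ U := by
  rw [isOpen_pi_iff]
  constructor
  · intro h p hp
    obtain ⟨F, u, hu, hsub⟩ := h p hp
    exact ⟨F, fun q hq => hsub fun i hi => by rw [hq i hi]; exact (hu i hi).2⟩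
  · intro h p hp
    obtain ⟨F, hF⟩ := h p hp
    exact ⟨F, fun i => {p i}, fun i _ => ⟨isOpen_discrete _, rfl⟩, fun q hq => hF q hq⟩

/-- A case of the Hewitt–Marczewski–Pondiczery theorem: after injecting `ι` into the Cantor space,
the functions depending on finitely many bits form a countable dense set. -/
theorem separableSpace_cantorCube {ι : Type*} (j : ι → ℕ → Bool) (hj : Function.Injective j) :
    TopologicalSpace.SeparableSpace (ι → Bool) := by
  classical
  let d : (Σ n : ℕ, (Fin n → Bool) → Bool) → ι → Bool := fun c i => c.2 fun k => j i k
  refine ⟨Set.range d, Set.countable_range d, fun x => mem_closure_iff.2 fun U hU hxU => ?_⟩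
  obtain ⟨F, hF⟩ := isOpen_iff_finset_agree.1 hU x hxU
  have hk : ∀ q : ι × ι, ∃ k, q.1 ≠ q.2 → j q.1 k ≠ j q.2 k := by
    intro q
    by_cases h : q.1 = q.2
    · exact ⟨0, fun h' => absurd h h'⟩
    · obtain ⟨k, hk⟩ := Function.ne_iff.1 (hj.ne h)
      exact ⟨k, fun _ => hk⟩
  choose k hk using hk
  let n := (F ×ˢ F).sup k + 1
  have hn : ∀ i ∈ F, ∀ i' ∈ F, (∀ l : Fin n, j i l = j i' l) → i = i' := by
    intro i hi i' hi' h
    by_contra hne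
    exact hk (i, i') hne (h ⟨k (i, i'),
      Nat.lt_succ_of_le (Finset.le_sup (f := k) (Finset.mk_mem_product hi hi'))⟩)
  refine ⟨d ⟨n, fun t => decide (∃ i ∈ F, (∀ l : Fin n, j i l = t l) ∧ x i = true)⟩,
    hF _ fun i hi => ?_, Set.mem_range_self _⟩
  rw [Bool.eq_iff_iff, decide_eq_true_iff]
  constructor
  · rintro ⟨i', hi', h, hx⟩
    rwa [← hn i' hi' i hi h]
  · exact fun h => ⟨i, hi, fun _ => rfl, h⟩

/-! ### One step of the construction: the constraint imposed at a coordinate -/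

theorem exists_bool_frequently {m : ℕ → ℕ} (hm : Tendsto m atTop atTop) :
    ∃ h : ℕ → Bool, ∀ b, ∃ᶠ n in atTop, h (m n) = b := by
  obtain ⟨φ, hφ, hmφ⟩ := strictMono_subseq_of_tendsto_atTop hm
  classical
  refine ⟨fun k => decide (∃ i, m (φ (2 * i)) = k), fun b => frequently_atTop.2 fun N => ?_⟩
  cases b
  · refine ⟨φ (2 * N + 1), le_trans (by omega) (hφ.le_apply (x := 2 * N + 1)), ?_⟩
    simp only [decide_eq_false_iff_not, not_exists]
    intro i hi
    have := hmφ.injective hi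
    omega
  · refine ⟨φ (2 * N), le_trans (by omega) (hφ.le_apply (x := 2 * N)), ?_⟩
    simp only [decide_eq_true_eq]
    exact ⟨N, rfl⟩

section Constraint

variable {I : Type*} [LinearOrder I]

/-- Membership of `p` in `V` depends only on the coordinates of `p` below `α`. -/
def DeterminedBelow (α : I) (V : Set (I → Bool × Bool)) : Prop :=
  ∀ ⦃p q⦄, Set.EqOn p q (Set.Iio α) → p ∈ V → q ∈ V

/-- Below `α`, the sequence `d` lies in `L`, converges to `y`, and never equals `y`. -/
structure IsNontrivialSeqBelow (α : I) (L : Set (I → Bool × Bool)) (d : ℕ → I → Bool × Bool)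
    (y : I → Bool × Bool) : Prop where
  mem : ∀ n, d n ∈ L
  tendsto : ∀ γ < α, ∀ᶠ n in atTop, d n γ = y γ
  ne : ∀ n, ∃ γ < α, d n γ ≠ y γ

/-- A function of the coordinates below `α` which is locally constant off the limit `y` of the
nontrivial sequence `d`, but oscillates along `d`. It is a function of the first place, in an
enumeration of the countably many coordinates, where a point differs from `y`. -/
theorem IsNontrivialSeqBelow.exists_oscillating {α : I} (hα : (Set.Iio α).Countable)
    {L : Set (I → Bool × Bool)} {d : ℕ → I → Bool × Bool} {y : I → Bool × Bool}
    (h : IsNontrivialSeqBelow α L d y) :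
    ∃ g : (I → Bool × Bool) → Bool,
      (∀ p q, Set.EqOn p q (Set.Iio α) → g p = g q) ∧
      (∀ p, (∃ γ < α, p γ ≠ y γ) → ∃ F : Finset I, ∀ q, (∀ i ∈ F, q i = p i) →
        g q = g p ∧ ∃ γ < α, q γ ≠ y γ) ∧
      ∀ b, ∃ᶠ n in atTop, g (d n) = b := by
  classical
  obtain ⟨u, hu⟩ := (hα.insert α).exists_eq_range ⟨α, Set.mem_insert _ _⟩
  have hsurj : ∀ γ < α, ∃ k, u k = γ := fun γ hγ => by
    have : γ ∈ Set.range u := hu ▸ Set.mem_insert_of_mem _ hγ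
    exact this
  let D : (I → Bool × Bool) → ℕ := fun p => sInf {k | u k < α ∧ p (u k) ≠ y (u k)}
  have hD : ∀ p, (∃ γ < α, p γ ≠ y γ) → u (D p) < α ∧ p (u (D p)) ≠ y (u (D p)) := by
    rintro p ⟨γ, hγ, hne⟩
    obtain ⟨k, rfl⟩ := hsurj γ hγ
    exact Nat.sInf_mem (s := {k | u k < α ∧ p (u k) ≠ y (u k)}) ⟨k, hγ, hne⟩
  have hD' : ∀ p k, k < D p → u k < α → p (u k) = y (u k) := by
    intro p k hk hlt
    by_contra hne
    exact Nat.notMem_of_lt_sInf hk ⟨hlt, hne⟩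
  have hlim : Tendsto (fun n => D (d n)) atTop atTop := by
    refine tendsto_atTop.2 fun N => ?_
    have : ∀ᶠ n in atTop, ∀ k ∈ Finset.range N, u k < α → d n (u k) = y (u k) := by
      rw [eventually_all_finset]
      intro k _
      by_cases hk : u k < α
      · exact (h.tendsto _ hk).mono fun n hn _ => hn
      · exact Eventually.of_forall fun n hk' => absurd hk' hk
    filter_upwards [this] with n hn
    by_contra hlt
    obtain ⟨h1, h2⟩ := hD _ (h.ne n)
    exact h2 (hn _ (Finset.mem_range.2 (not_le.1 hlt)) h1)
  obtain ⟨b, hb⟩ := exists_bool_frequently hlim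
  refine ⟨fun p => b (D p), fun p q hpq => ?_, fun p hp => ?_, hb⟩
  · have : {k | u k < α ∧ p (u k) ≠ y (u k)} = {k | u k < α ∧ q (u k) ≠ y (u k)} := by
      ext k
      exact and_congr_right fun hk => by rw [hpq hk]
    simp only [D, this]
  · refine ⟨(Finset.range (D p + 1)).image u, fun q hq => ?_⟩
    have hq' : ∀ k ≤ D p, q (u k) = p (u k) := fun k hk =>
      hq _ (Finset.mem_image_of_mem _ (Finset.mem_range.2 (Nat.lt_succ_of_le hk)))
    have hqD : u (D p) < α ∧ q (u (D p)) ≠ y (u (D p)) := by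
      rw [hq' _ le_rfl]; exact hD p hp
    have hex : ∃ γ < α, q γ ≠ y γ := ⟨_, hqD⟩
    have : D q = D p := by
      refine le_antisymm (Nat.sInf_le hqD) ?_
      by_contra hlt
      rw [not_le] at hlt
      refine (hD q hex).2 ?_
      rw [hq' _ hlt.le]
      exact hD' p _ hlt (hD q hex).1
    exact ⟨by simp only [this], hex⟩

/-- The requirements on the set `R` of points allowed at step `α`, where `L` is the set of points
allowed by the earlier steps and `d` is the sequence guessed at `α`. The second bit of the
coordinate `α` is restricted in terms of the coordinates below `α`, the first bit is free. -/
structure IsConstraint (α : I) (d : ℕ → I → Bool × Bool) (L R : Set (I → Bool × Bool)) :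
    Prop where
  isClosed : IsClosed R
  congr : ∀ ⦃p q⦄, Set.EqOn p q (Set.Iio α) → (p α).2 = (q α).2 → p ∈ R → q ∈ R
  exists_update : ∀ p, ∃ b, ∀ x, Function.update p α (x, b) ∈ R
  /-- Arbitrarily close to `p`, below `α`, there is an open set on which the second bit of the
  coordinate `α` is forced to be that of `p`. -/
  exists_isOpen : ∀ ⦃p V⦄, p ∈ L → p ∈ R → IsOpen V → DeterminedBelow α V → p ∈ V →
    ∃ V' ⊆ V, IsOpen V' ∧ DeterminedBelow α V' ∧ (V' ∩ L).Nonempty ∧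
      ∀ q ∈ V', q ∈ R → (q α).2 = (p α).2
  /-- No nontrivial convergent sequence whose restriction to `α` is `d` survives step `α`. -/
  not_tendsto : ∀ ⦃s : ℕ → I → Bool × Bool⦄ ⦃y⦄, (∀ n, s n ∈ L) → (∀ n, s n ∈ R) →
    (∀ n, ∀ γ < α, d n γ = s n γ) → (∀ n, ∃ γ < α, s n γ ≠ y γ) → ¬ Tendsto s atTop (𝓝 y)

theorem eventually_eq_of_tendsto_pi_discrete {ι β : Type*} [TopologicalSpace β]
    [DiscreteTopology β] {s : ℕ → ι → β} {y : ι → β} (h : Tendsto s atTop (𝓝 y)) (i : ι) :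
    ∀ᶠ n in atTop, s n i = y i := by
  have := tendsto_pi_nhds.1 h i
  rwa [nhds_discrete, tendsto_pure] at this

/-- If the guess `d` is a nontrivial sequence in `L` converging to `y` below `α`, the second bit at
`α` is required to be the value of an oscillating function, except over `y`, where it is free;
otherwise it is required to be `false`. -/
theorem exists_isConstraint {α : I} (hα : (Set.Iio α).Countable) (d : ℕ → I → Bool × Bool)
    {L : Set (I → Bool × Bool)} (hL : DeterminedBelow α L) : ∃ R, IsConstraint α d L R := by
  classical
  by_cases hy : ∃ y, IsNontrivialSeqBelow α L d y
  swap
  · refine ⟨{p | (p α).2 = false}, ?_, ?_, ?_, ?_, ?_⟩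
    · exact isClosed_eq (by fun_prop) continuous_const
    · intro p q _ h hp
      exact h.symm.trans hp
    · exact fun p => ⟨false, fun x => by simp⟩
    · exact fun p V hpL hpR hV hVα hpV =>
        ⟨V, subset_rfl, hV, hVα, ⟨p, hpV, hpL⟩, fun q _ hq => hq.trans hpR.symm⟩
    · intro s y hsL _ hds hne hlim
      refine hy ⟨y, fun n => hL (fun γ hγ => (hds n γ hγ).symm) (hsL n), fun γ hγ => ?_,
        fun n => ?_⟩
      · filter_upwards [eventually_eq_of_tendsto_pi_discrete hlim γ] with n hn
        rw [hds n γ hγ, hn]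
      · obtain ⟨γ, hγ, h⟩ := hne n
        exact ⟨γ, hγ, by rwa [hds n γ hγ]⟩
  obtain ⟨y, hy⟩ := hy
  obtain ⟨g, hg, hgc, hgo⟩ := hy.exists_oscillating hα
  refine ⟨{p | (∃ γ < α, p γ ≠ y γ) → (p α).2 = g p}, ?_, ?_, ?_, ?_, ?_⟩
  · rw [← isOpen_compl_iff, isOpen_iff_finset_agree]
    intro p hp
    simp only [Set.mem_compl_iff, Set.mem_ofPred_eq, Classical.not_imp] at hp ⊢
    obtain ⟨F, hF⟩ := hgc p hp.1
    refine ⟨insert α F, fun q hq => ?_⟩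
    obtain ⟨h1, h2⟩ := hF q fun i hi => hq i (Finset.mem_insert_of_mem hi)
    exact ⟨h2, by rw [h1, hq α (Finset.mem_insert_self _ _)]; exact hp.2⟩
  · rintro p q hpq h2 hp ⟨γ, hγ, hne⟩
    rw [← h2, ← hg p q hpq]
    exact hp ⟨γ, hγ, by rwa [hpq hγ]⟩
  · refine fun p => ⟨g p, fun x _ => ?_⟩
    rw [Function.update_self]
    exact hg _ _ fun γ hγ => (Function.update_of_ne (ne_of_lt hγ) _ _).symm
  · intro p V hpL hpR hV hVα hpV
    obtain ⟨p', hp'V, hp'L, hp'ne, hgp'⟩ :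
        ∃ p' ∈ V, p' ∈ L ∧ (∃ γ < α, p' γ ≠ y γ) ∧ g p' = (p α).2 := by
      by_cases hp : ∃ γ < α, p γ ≠ y γ
      · exact ⟨p, hpV, hpL, hp, (hpR hp).symm⟩
      -- Over `y` both bits are allowed, and both are values of `g` at terms of `d` close to `y`.
      push Not at hp
      obtain ⟨F, hF⟩ := isOpen_iff_finset_agree.1 hV p hpV
      have hev : ∀ᶠ n in atTop, ∀ i ∈ F, i < α → d n i = p i := by
        rw [eventually_all_finset]
        intro i _
        by_cases hi : i < α
        · exact (hy.tendsto i hi).mono fun n hn _ => hn.trans (hp i hi).symm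
        · exact Eventually.of_forall fun n h => absurd h hi
      obtain ⟨n, hgn, hn⟩ := ((hgo (p α).2).and_eventually hev).exists
      refine ⟨d n, ?_, hy.mem n, hy.ne n, hgn⟩
      refine hVα (p := fun i => if i < α then d n i else p i) ?_ (hF _ fun i hi => ?_)
      · exact fun i hi => if_pos hi
      · by_cases hiα : i < α
        · simp only [hiα, if_true]; exact hn i hi hiα
        · simp only [hiα, if_false]
    refine ⟨{q | q ∈ V ∧ (∃ γ < α, q γ ≠ y γ) ∧ g q = (p α).2}, fun q hq => hq.1, ?_, ?_,
      ⟨p', ⟨hp'V, hp'ne, hgp'⟩, hp'L⟩, fun q hq hqR => (hqR hq.2.1).trans hq.2.2⟩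
    · rw [isOpen_iff_finset_agree]
      rintro q ⟨hqV, hqne, hgq⟩
      obtain ⟨F, hF⟩ := isOpen_iff_finset_agree.1 hV q hqV
      obtain ⟨G, hG⟩ := hgc q hqne
      refine ⟨F ∪ G, fun r hr => ?_⟩
      obtain ⟨h1, h2⟩ := hG r fun i hi => hr i (Finset.mem_union_right _ hi)
      exact ⟨hF r fun i hi => hr i (Finset.mem_union_left _ hi), h2, h1.trans hgq⟩
    · rintro q r hqr ⟨hqV, ⟨γ, hγ, hne⟩, hgq⟩
      exact ⟨hVα hqr hqV, ⟨γ, hγ, by rwa [← hqr hγ]⟩, (hg q r hqr).symm.trans hgq⟩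
  · intro s z _ hsR hds _ hlim
    have hbit : ∀ n, (s n α).2 = g (d n) := by
      intro n
      obtain ⟨γ, hγ, hne⟩ := hy.ne n
      rw [hsR n ⟨γ, hγ, by rwa [← hds n γ hγ]⟩]
      exact hg _ _ fun γ hγ => (hds n γ hγ).symm
    have hev := eventually_eq_of_tendsto_pi_discrete hlim α
    obtain ⟨n, hn, hn'⟩ := ((hgo (!(z α).2)).and_eventually hev).exists
    rw [← hbit, hn'] at hn
    simp at hn

end Constraint

/-! ### The compact space without convergent sequences -/

section Constraints

variable {I : Type*} [LinearOrder I]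

/-- `R` is a family of constraints, each of them relative to the intersection of the previous ones
and to the guesses `d`. The space of interest is the intersection of all `R α`. -/
def IsConstraintFamily (d : I → ℕ → I → Bool × Bool) (R : I → Set (I → Bool × Bool)) : Prop :=
  ∀ α, IsConstraint α (d α) {p | ∀ γ < α, p ∈ R γ} (R α)

variable {d : I → ℕ → I → Bool × Bool} {R : I → Set (I → Bool × Bool)}

/-- If the guesses catch every sequence, all convergent sequences of points satisfying the
constraints are trivial. -/
theorem IsConstraintFamily.eventually_eq (hR : IsConstraintFamily d R)
    (hb : ∀ s : Set I, s.Countable → ∃ b, ∀ a ∈ s, a < b)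
    (hd : ∀ (s : ℕ → I → Bool × Bool) (δ : I), ∃ α, δ < α ∧ ∀ n, ∀ γ < α, d α n γ = s n γ)
    {s : ℕ → I → Bool × Bool} {y : I → Bool × Bool} (hs : ∀ n γ, s n ∈ R γ)
    (hlim : Tendsto s atTop (𝓝 y)) : ∀ᶠ n in atTop, s n = y := by
  by_contra hne
  obtain ⟨φ, hφ, hφne⟩ := extraction_of_frequently_atTop (not_eventually.1 hne)
  choose i hi using fun n => Function.ne_iff.1 (hφne n)
  obtain ⟨δ, hδ⟩ := hb (Set.range i) (Set.countable_range i)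
  obtain ⟨α, hδα, hα⟩ := hd (fun n => s (φ n)) δ
  exact (hR α).not_tendsto (fun n γ _ => hs (φ n) γ) (fun n => hs (φ n) α) hα
    (fun n => ⟨i n, (hδ _ ⟨n, rfl⟩).trans hδα, hi n⟩) (hlim.comp hφ.tendsto_atTop)

variable [WellFoundedLT I]

theorem exists_isConstraintFamily (hc : ∀ a : I, (Set.Iio a).Countable)
    (d : I → ℕ → I → Bool × Bool) : ∃ R, IsConstraintFamily d R := by
  have hsel : ∀ (α : I) (L : Set (I → Bool × Bool)),
      ∃ R, DeterminedBelow α L → IsConstraint α (d α) L R := by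
    intro α L
    by_cases hL : DeterminedBelow α L
    · obtain ⟨R, hR⟩ := exists_isConstraint (hc α) (d α) hL
      exact ⟨R, fun _ => hR⟩
    · exact ⟨∅, fun h => absurd h hL⟩
  choose sel hsel using hsel
  -- The recursion runs before its values are known to depend only on the coordinates below `α`;
  -- this is verified afterwards, by induction.
  let R : I → Set (I → Bool × Bool) := WellFounded.fix wellFounded_lt
    fun α rec => sel α {p | ∀ γ (h : γ < α), p ∈ rec γ h}
  have hRα : ∀ α, R α = sel α {p | ∀ γ < α, p ∈ R γ} := fun α =>
    WellFounded.fix_eq wellFounded_lt _ α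
  refine ⟨R, fun α => ?_⟩
  induction α using WellFoundedLT.induction with
  | ind α ih =>
    have := hsel α {p | ∀ γ < α, p ∈ R γ} fun p q hpq hp γ hγ =>
      (ih γ hγ).congr (fun δ hδ => hpq (lt_trans hδ hγ)) (by rw [hpq hγ]) (hp γ hγ)
    rwa [← hRα] at this

/-- Points satisfying the constraints below `α` extend to points satisfying all of them, with
arbitrary first bits from `α` on. -/
theorem IsConstraintFamily.exists_extension (hR : IsConstraintFamily d R) {α : I}
    {p : I → Bool × Bool} (hp : ∀ γ < α, p ∈ R γ) (x : I → Bool) (hx : ∀ γ < α, x γ = (p γ).1) :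
    ∃ q, (∀ γ, q ∈ R γ) ∧ Set.EqOn q p (Set.Iio α) ∧ ∀ γ, (q γ).1 = x γ := by
  classical
  choose b hb using fun γ => (hR γ).exists_update
  -- The second bits from `α` on are chosen recursively, one allowed value at a time.
  let v : I → Bool := WellFounded.fix wellFounded_lt fun γ rec =>
    if γ < α then (p γ).2 else b γ fun δ => if h : δ < γ then (x δ, rec δ h) else (false, false)
  have hv : ∀ γ, v γ = if γ < α then (p γ).2 else
      b γ fun δ => if δ < γ then (x δ, v δ) else (false, false) := fun γ =>
    WellFounded.fix_eq wellFounded_lt _ γ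
  have heq : Set.EqOn (fun γ => (x γ, v γ)) p (Set.Iio α) := by
    intro γ hγ
    have h1 := hv γ
    rw [if_pos (show γ < α from hγ)] at h1
    exact Prod.ext (hx γ hγ) h1
  refine ⟨fun γ => (x γ, v γ), fun γ => ?_, heq, fun γ => rfl⟩
  by_cases hγ : γ < α
  · exact (hR γ).congr (fun δ hδ => (heq (lt_trans hδ hγ)).symm) (by rw [← heq hγ]) (hp γ hγ)
  · have h1 := hv γ
    rw [if_neg hγ] at h1
    refine (hR γ).congr ?_ ?_ (hb γ (fun δ => if δ < γ then (x δ, v δ) else (false, false)) (x γ))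
    · intro δ hδ
      rw [Function.update_of_ne (ne_of_lt hδ)]
      exact if_pos hδ
    · rw [Function.update_self]
      exact h1.symm

theorem IsConstraintFamily.exists_mem (hR : IsConstraintFamily d R) (x : I → Bool) :
    ∃ q, (∀ γ, q ∈ R γ) ∧ ∀ γ, (q γ).1 = x γ := by
  rcases isEmpty_or_nonempty I with hI | hI
  · exact ⟨fun _ => (false, false), fun γ => isEmptyElim γ, fun γ => isEmptyElim γ⟩
  · obtain ⟨m, hm⟩ : ∃ m : I, ∀ γ, ¬ γ < m :=
      ⟨wellFounded_lt.min Set.univ Set.univ_nonempty,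
        fun γ => wellFounded_lt.not_lt_min _ (Set.mem_univ γ)⟩
    obtain ⟨q, hq, -, hqx⟩ := hR.exists_extension (α := m) (p := fun _ => (false, false))
      (fun γ hγ => absurd hγ (hm γ)) x (fun γ hγ => absurd hγ (hm γ))
    exact ⟨q, hq, hqx⟩

/-- The projection to the first bits is irreducible, below each `α`: every nonempty open set
contains the whole preimage of a nonempty open set. -/
theorem IsConstraintFamily.exists_isOpen_below (hR : IsConstraintFamily d R) (α : I) :
    ∀ (p : I → Bool × Bool) (U : Set (I → Bool × Bool)), IsOpen U → DeterminedBelow α U → p ∈ U →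
      (∀ γ < α, p ∈ R γ) →
      ∃ W : Set (I → Bool), IsOpen W ∧ W.Nonempty ∧
        (∀ x y, Set.EqOn x y (Set.Iio α) → x ∈ W → y ∈ W) ∧
        ∀ q, (∀ γ < α, q ∈ R γ) → (fun i => (q i).1) ∈ W → q ∈ U := by
  classical
  induction α using WellFoundedLT.induction with
  | ind α ih =>
  intro p U hU hUα hpU hp
  obtain ⟨F', hF'⟩ := isOpen_iff_finset_agree.1 hU p hpU
  let F := F'.filter (· < α)
  have hF : ∀ q, (∀ i ∈ F, q i = p i) → q ∈ U := by
    intro q hq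
    refine hUα (p := fun i => if i < α then q i else p i) (fun i hi => if_pos hi)
      (hF' _ fun i hi => ?_)
    by_cases hiα : i < α
    · simp only [hiα, if_true]; exact hq i (Finset.mem_filter.2 ⟨hi, hiα⟩)
    · simp only [hiα, if_false]
  rcases F.eq_empty_or_nonempty with hFe | hFne
  · exact ⟨Set.univ, isOpen_univ, Set.univ_nonempty, fun _ _ _ _ => trivial,
      fun q _ _ => hF q (by simp [hFe])⟩
  -- Treat the largest relevant coordinate `γ` by the constraint at `γ`, the others by induction.
  let γ := F.max' hFne
  have hγF : γ ∈ F := F.max'_mem hFne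
  have hγα : γ < α := (Finset.mem_filter.1 hγF).2
  have hVo : IsOpen {q : I → Bool × Bool | ∀ i ∈ F, i < γ → q i = p i} := by
    rw [isOpen_iff_finset_agree]
    exact fun q hq => ⟨F, fun r hr i hi hiγ => (hr i hi).trans (hq i hi hiγ)⟩
  obtain ⟨V', hV'V, hV'o, hV'γ, ⟨p', hp'V', hp'⟩, hbit⟩ := (hR γ).exists_isOpen
    (p := p) (V := {q | ∀ i ∈ F, i < γ → q i = p i}) (fun δ hδ => hp δ (hδ.trans hγα))
    (hp γ hγα) hVo (fun q r hqr hq i hi hiγ => (hqr hiγ).symm.trans (hq i hi hiγ))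
    (fun i _ _ => rfl)
  obtain ⟨W, hWo, ⟨w, hw⟩, hWγ, hW⟩ := ih γ hγα p' V' hV'o hV'γ hp'V' hp'
  refine ⟨W ∩ {x | x γ = (p γ).1}, hWo.inter ?_, ⟨Function.update w γ (p γ).1, ?_, ?_⟩, ?_, ?_⟩
  · exact (isOpen_discrete ({(p γ).1} : Set Bool)).preimage
      (continuous_apply (A := fun _ : I => Bool) γ)
  · exact hWγ w _ (fun i hi => (Function.update_of_ne (ne_of_lt hi) _ _).symm) hw
  · exact Function.update_self _ _ _
  · rintro x y hxy ⟨hxW, hxγ⟩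
    exact ⟨hWγ x y (fun i hi => hxy (lt_trans hi hγα)) hxW, (hxy hγα).symm.trans hxγ⟩
  · rintro q hq ⟨hqW, hqγ⟩
    have hqV' := hW q (fun δ hδ => hq δ (hδ.trans hγα)) hqW
    refine hF q fun i hi => ?_
    rcases (F.le_max' i hi).lt_or_eq with hlt | heq
    · exact hV'V hqV' i hi hlt
    · rw [heq]
      exact Prod.ext hqγ (hbit q hqV' (hq γ hγα))

theorem IsConstraintFamily.exists_isOpen (hR : IsConstraintFamily d R)
    (hb : ∀ s : Set I, s.Countable → ∃ b, ∀ a ∈ s, a < b) {p : I → Bool × Bool}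
    {U : Set (I → Bool × Bool)} (hU : IsOpen U) (hpU : p ∈ U) (hp : ∀ γ, p ∈ R γ) :
    ∃ W : Set (I → Bool), IsOpen W ∧ W.Nonempty ∧
      ∀ q, (∀ γ, q ∈ R γ) → (fun i => (q i).1) ∈ W → q ∈ U := by
  obtain ⟨F, hF⟩ := isOpen_iff_finset_agree.1 hU p hpU
  obtain ⟨α, hα⟩ := hb F F.countable_toSet
  have ho : IsOpen {q : I → Bool × Bool | ∀ i ∈ F, q i = p i} := by
    rw [isOpen_iff_finset_agree]
    exact fun q hq => ⟨F, fun r hr i hi => (hr i hi).trans (hq i hi)⟩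
  obtain ⟨W, hWo, hWne, -, hW⟩ := hR.exists_isOpen_below α p {q | ∀ i ∈ F, q i = p i} ho
    (fun q r hqr hq i hi => (hqr (hα i hi)).symm.trans (hq i hi)) (fun i _ => rfl)
    (fun γ _ => hp γ)
  exact ⟨W, hWo, hWne, fun q hq hqW => hF q (hW q (fun γ _ => hq γ) hqW)⟩

end Constraints

/-- Under diamond there are guesses catching every sequence of points of `(Bool × Bool) ^ ω₁`. -/
theorem Diamond.exists_guess_seq (h : Diamond) :
    ∃ d : (ω₁ : Ordinal.{0}).ToType → ℕ → (ω₁ : Ordinal.{0}).ToType → Bool × Bool,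
      ∀ (s : ℕ → (ω₁ : Ordinal.{0}).ToType → Bool × Bool) (δ : (ω₁ : Ordinal.{0}).ToType),
        ∃ α, δ < α ∧ ∀ n, ∀ γ < α, d α n γ = s n γ := by
  classical
  obtain ⟨A, hA⟩ := h.exists_guess
  have hinf : ℵ₀ ≤ #(ω₁ : Ordinal.{0}).ToType := by
    rw [mk_toType_omega_one]; exact Cardinal.aleph0_le_aleph 1
  obtain ⟨e⟩ : Nonempty ((ω₁ : Ordinal.{0}).ToType × (ℕ × Bool) ↪ (ω₁ : Ordinal.{0}).ToType) := by
    rw [← Cardinal.le_def, Cardinal.mk_prod, Cardinal.lift_id, Cardinal.lift_id]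
    exact Cardinal.mul_le_of_le hinf le_rfl ((Cardinal.mk_le_aleph0).trans hinf)
  choose f hf using fun γ => exists_bound_of_countable_toType_omega_one
    (Set.range fun k : ℕ × Bool => e (γ, k)) (Set.countable_range _)
  refine ⟨fun α n γ => (decide (e (γ, n, false) ∈ A α), decide (e (γ, n, true) ∈ A α)),
    fun s δ => ?_⟩
  obtain ⟨α, hδ, hfα, hX⟩ := hA {i | ∃ γ n, (i = e (γ, n, false) ∧ (s n γ).1 = true) ∨
    (i = e (γ, n, true) ∧ (s n γ).2 = true)} f δ
  refine ⟨α, hδ, fun n γ hγ => ?_⟩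
  have hlt : ∀ b, e (γ, n, b) < α := fun b => (hf γ _ ⟨(n, b), rfl⟩).trans (hfα γ hγ)
  have h1 := hX _ (hlt false)
  have h2 := hX _ (hlt true)
  simp only [Set.mem_ofPred_eq, e.injective.eq_iff, Prod.mk.injEq, Bool.false_eq_true,
    Bool.true_eq_false, and_false, false_and, or_false, false_or, and_true] at h1 h2
  refine Prod.ext ?_ ?_
  · rw [Bool.eq_iff_iff, decide_eq_true_iff, ← h1]
    exact ⟨by rintro ⟨_, _, ⟨rfl, rfl⟩, h⟩; exact h, fun h => ⟨γ, n, ⟨rfl, rfl⟩, h⟩⟩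
  · rw [Bool.eq_iff_iff, decide_eq_true_iff, ← h2]
    exact ⟨by rintro ⟨_, _, ⟨rfl, rfl⟩, h⟩; exact h, fun h => ⟨γ, n, ⟨rfl, rfl⟩, h⟩⟩

/-! ### Subspaces of Cantor cubes -/

section CubeSubspace

variable {Γ : Type u} {X : Set (Γ → Bool)}

theorem exists_finset_of_isOpen_subtype {U : Set X} (hU : IsOpen U) {k : X} (hk : k ∈ U) :
    ∃ F : Finset Γ, ∀ k' : X, (∀ i ∈ F, k'.1 i = k.1 i) → k' ∈ U := by
  obtain ⟨V, hV, rfl⟩ := isOpen_induced_iff.1 hU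
  obtain ⟨F, hF⟩ := isOpen_iff_finset_agree.1 hV k.1 hk
  exact ⟨F, fun k' h => hF _ h⟩

theorem isSigmaSubset_countable_support (X : Set (Γ → Bool)) :
    IsSigmaSubset {k : X | {i | k.1 i = true}.Countable} := by
  refine ⟨Γ, fun k i => if k.1 i = true then 1 else 0, ?_, ?_, ?_⟩
  · refine continuous_pi fun i => ?_
    exact (continuous_of_discreteTopology (f := fun b : Bool => if b = true then (1 : ℝ) else 0)).comp
      ((continuous_apply i).comp continuous_subtype_val)
  · intro k k' h
    refine Subtype.ext (funext fun i => ?_)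
    have hi := congrFun h i
    cases h1 : k.1 i <;> cases h2 : k'.1 i <;> simp [h1, h2] at hi ⊢
  · ext k
    simp [SigmaProduct]

/-- A subspace of a Cantor cube of weight `ℵ₁` has weight at most `ℵ₁`. -/
theorem topWeight_cubeSubspace_le (hΓ : #Γ = ℵ₁) : topWeight X ≤ ℵ₁ := by
  let b : Finset (Γ × Bool) → Set X := fun F => {k | ∀ q ∈ F, k.1 q.1 = q.2}
  have hbase : TopologicalSpace.IsTopologicalBasis (Set.range b) := by
    refine TopologicalSpace.isTopologicalBasis_of_isOpen_of_nhds ?_ ?_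
    · rintro _ ⟨F, rfl⟩
      have : b F = ⋂ q ∈ F, {k : X | k.1 q.1 = q.2} := by ext; simp [b]
      rw [this]
      exact isOpen_biInter_finset fun q _ => (isOpen_discrete ({q.2} : Set Bool)).preimage
        ((continuous_apply (A := fun _ : Γ => Bool) q.1).comp continuous_subtype_val)
    · classical
      intro k U hk hU
      obtain ⟨F, hF⟩ := exists_finset_of_isOpen_subtype hU hk
      refine ⟨_, ⟨F.image fun i => (i, k.1 i), rfl⟩, ?_, fun k' hk' => hF k' fun i hi => ?_⟩
      · simp [b]
      · exact hk' (i, k.1 i) (Finset.mem_image_of_mem _ hi)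
  have hinf : ℵ₀ ≤ #Γ := hΓ ▸ Cardinal.aleph0_le_aleph 1
  have : Infinite Γ := Cardinal.infinite_iff.2 hinf
  calc topWeight X ≤ #(Set.range b) := csInf_le' ⟨_, hbase, rfl⟩
    _ ≤ #(Finset (Γ × Bool)) := Cardinal.mk_range_le
    _ = #(Γ × Bool) := Cardinal.mk_finset_of_infinite _
    _ = #Γ * 2 := by simp
    _ ≤ #Γ := Cardinal.mul_le_of_le hinf le_rfl ((Cardinal.natCast_lt_aleph0 (n := 2)).le.trans hinf)
    _ = ℵ₁ := hΓ

end CubeSubspace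

/-- The points of a Hausdorff space of countable weight are `G_δ`. -/
theorem aleph_one_le_topWeight {K : Type u} [TopologicalSpace K] [T2Space K] [Nonempty K]
    (h : ¬ HasGδPoint K) : ℵ₁ ≤ topWeight K := by
  refine le_csInf ⟨_, _, TopologicalSpace.isTopologicalBasis_opens, rfl⟩ ?_
  rintro _ ⟨B, hB, rfl⟩
  rw [Cardinal.aleph_one_le_iff]
  by_contra hlt
  rw [not_lt, Cardinal.le_aleph0_iff_set_countable] at hlt
  have : SecondCountableTopology K := hB.secondCountableTopology hlt
  obtain ⟨x⟩ := ‹Nonempty K›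
  exact h ⟨x, IsGδ.singleton x⟩

/-! ### The Valdivia compactum -/

section Gate

variable {I : Type} [LinearOrder I]

/-- Writing `p = (x, v)`, the coordinates of `gate p` are the bits `x β` and, for `α ≤ β`, the bits
`v α` gated by `x β`; coordinates `(some α, β)` with `β < α` are padding. So `v α` is visible only
from some `β ≥ α` with `x β = 1`, and `gate p` has countable support exactly when `x` has. -/
def gate (p : I → Bool × Bool) : Option I × I → Bool
  | (none, β) => (p β).1
  | (some α, β) => (p β).1 && (decide (α ≤ β) && (p α).2)

theorem continuous_gate : Continuous (gate : (I → Bool × Bool) → Option I × I → Bool) := by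
  refine continuous_pi ?_
  rintro ⟨_ | α, β⟩
  · exact continuous_fst.comp (continuous_apply β)
  · have h : Continuous fun p : I → Bool × Bool => (p β, p α) := by fun_prop
    exact (continuous_of_discreteTopology (f := fun q : (Bool × Bool) × (Bool × Bool) =>
      q.1.1 && (decide (α ≤ β) && q.2.2))).comp h

theorem gate_congr {p q : I → Bool × Bool} {α β : I} (h : Set.EqOn p q (Set.Iio α)) (hβ : β < α)
    (o : Option I) : gate p (o, β) = gate q (o, β) := by
  cases o with
  | none => simp only [gate, h hβ]
  | some γ =>
    by_cases hγ : γ ≤ β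
    · simp only [gate, h hβ, h (hγ.trans_lt hβ : γ < α)]
    · simp [gate, hγ]

theorem countable_support_gate (hc : ∀ a : I, (Set.Iio a).Countable) {p : I → Bool × Bool} {α : I}
    (h : ∀ β, α ≤ β → (p β).1 = false) : {i | gate p i = true}.Countable := by
  refine ((((hc α).image some).insert none).prod (hc α)).mono ?_
  rintro ⟨o, β⟩ hi
  have hβ : β < α := by
    by_contra hβ
    have := h β (not_lt.1 hβ)
    cases o <;> simp [gate, this] at hi
  refine ⟨?_, hβ⟩
  cases o with
  | none => exact Set.mem_insert _ _
  | some γ =>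
    have hγ : γ ≤ β := by
      simp only [gate, Set.mem_ofPred_eq, Bool.and_eq_true, decide_eq_true_eq] at hi
      exact hi.2.1
    exact Set.mem_insert_of_mem _ ⟨γ, hγ.trans_lt hβ, rfl⟩

/-- At a point of uncountable support every gate is eventually open, so `gate` reflects convergence
there. -/
theorem tendsto_of_tendsto_gate (hc : ∀ a : I, (Set.Iio a).Countable) {s : ℕ → I → Bool × Bool}
    {p : I → Bool × Bool} (hp : ¬ {i | gate p i = true}.Countable)
    (h : Tendsto (fun n => gate (s n)) atTop (𝓝 (gate p))) : Tendsto s atTop (𝓝 p) := by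
  refine tendsto_pi_nhds.2 fun α => ?_
  rw [nhds_discrete, tendsto_pure]
  obtain ⟨β, hαβ, hβ⟩ : ∃ β, α ≤ β ∧ (p β).1 = true := by
    by_contra! hcon
    exact hp (countable_support_gate hc fun β hβ => by simpa using hcon β hβ)
  filter_upwards [eventually_eq_of_tendsto_pi_discrete h (none, α),
    eventually_eq_of_tendsto_pi_discrete h (none, β),
    eventually_eq_of_tendsto_pi_discrete h (some α, β)] with n h1 h2 h3
  simp only [gate] at h1 h2 h3
  rw [h2, hβ] at h3
  exact Prod.ext h1 (by simpa [hαβ] using h3)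

variable {d : I → ℕ → I → Bool × Bool} {R : I → Set (I → Bool × Bool)}

/-- The compactum: the gated image of the set of points satisfying all constraints. -/
def gatedSpace (R : I → Set (I → Bool × Bool)) : Set (Option I × I → Bool) :=
  gate '' {p | ∀ γ, p ∈ R γ}

theorem IsConstraintFamily.isCompact_gatedSpace (hR : IsConstraintFamily d R) :
    IsCompact (gatedSpace R) := by
  refine IsCompact.image (IsClosed.isCompact ?_) continuous_gate
  have : {p | ∀ γ, p ∈ R γ} = ⋂ γ, R γ := by ext; simp
  rw [this]
  exact isClosed_iInter fun γ => (hR γ).isClosed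

/-- No nontrivial sequence of the compactum converges to a point of uncountable support. -/
theorem IsConstraintFamily.eventually_eq_of_tendsto_gatedSpace (hR : IsConstraintFamily d R)
    (hc : ∀ a : I, (Set.Iio a).Countable) (hb : ∀ s : Set I, s.Countable → ∃ b, ∀ a ∈ s, a < b)
    (hd : ∀ (s : ℕ → I → Bool × Bool) (δ : I), ∃ α, δ < α ∧ ∀ n, ∀ γ < α, d α n γ = s n γ)
    (s : ℕ → gatedSpace R) (k : gatedSpace R) (hk : ¬ {i | k.1 i = true}.Countable)
    (hlim : Tendsto s atTop (𝓝 k)) : ∀ᶠ n in atTop, s n = k := by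
  choose p hp hps using fun n => (s n).2
  obtain ⟨_, q, hq, rfl⟩ := k
  have h1 : Tendsto (fun n => gate (p n)) atTop (𝓝 (gate q)) := by
    simpa only [hps, Function.comp_def] using (continuous_subtype_val.tendsto _).comp hlim
  filter_upwards [hR.eventually_eq hb hd hp (tendsto_of_tendsto_gate hc hk h1)] with n hn
  exact Subtype.ext (by rw [← hps n, hn])

variable [WellFoundedLT I]

theorem IsConstraintFamily.dense_countable_support (hR : IsConstraintFamily d R)
    (hc : ∀ a : I, (Set.Iio a).Countable) (hb : ∀ s : Set I, s.Countable → ∃ b, ∀ a ∈ s, a < b) :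
    Dense {k : gatedSpace R | {i | k.1 i = true}.Countable} := by
  classical
  refine dense_iff_inter_open.2 ?_
  rintro U hU ⟨⟨_, p, hp, rfl⟩, hkU⟩
  obtain ⟨F, hF⟩ := exists_finset_of_isOpen_subtype hU hkU
  obtain ⟨α, hα⟩ := hb (Prod.snd '' (F : Set (Option I × I))) (F.countable_toSet.image _)
  obtain ⟨q, hq, hqp, hqx⟩ := hR.exists_extension (α := α) (fun γ _ => hp γ)
    (fun γ => if γ < α then (p γ).1 else false) (fun γ hγ => if_pos hγ)
  refine ⟨⟨gate q, q, hq, rfl⟩, hF _ fun i hi => gate_congr hqp (hα _ ⟨i, hi, rfl⟩) i.1, ?_⟩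
  exact countable_support_gate hc (α := α) fun β hβ => by rw [hqx, if_neg hβ.not_gt]

theorem IsConstraintFamily.not_hasGδPoint (hR : IsConstraintFamily d R)
    (hb : ∀ s : Set I, s.Countable → ∃ b, ∀ a ∈ s, a < b) : ¬ HasGδPoint (gatedSpace R) := by
  classical
  rintro ⟨⟨_, p, hp, rfl⟩, T, hT, hTc, hTk⟩
  have hmem : ∀ t ∈ T, (⟨gate p, p, hp, rfl⟩ : gatedSpace R) ∈ t := fun t ht =>
    Set.mem_sInter.1 (hTk ▸ Set.mem_singleton _) t ht
  choose! F hF using fun t ht => exists_finset_of_isOpen_subtype (hT t ht) (hmem t ht)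
  obtain ⟨α, hα⟩ := hb (Prod.snd '' ⋃ t ∈ T, (F t : Set (Option I × I)))
    ((hTc.biUnion fun t _ => (F t).countable_toSet).image _)
  obtain ⟨q, hq, hqp, hqx⟩ := hR.exists_extension (α := α) (fun γ _ => hp γ)
    (fun γ => if γ < α then (p γ).1 else !(p γ).1) (fun γ hγ => if_pos hγ)
  have hqT : (⟨gate q, q, hq, rfl⟩ : gatedSpace R) ∈ ⋂₀ T := fun t ht =>
    hF t ht _ fun i hi => gate_congr hqp
      (hα _ ⟨i, Set.mem_biUnion ht hi, rfl⟩) i.1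
  rw [← hTk] at hqT
  have h1 : gate q = gate p := congrArg Subtype.val hqT
  have h2 : (q α).1 = (p α).1 := congrFun h1 (none, α)
  rw [hqx, if_neg (lt_irrefl α)] at h2
  simp at h2

/-- The countable chain condition is inherited from the separable cube `Bool ^ I` of first bits,
via irreducibility of the projection to it. -/
theorem IsConstraintFamily.hasCCC (hR : IsConstraintFamily d R)
    (hb : ∀ s : Set I, s.Countable → ∃ b, ∀ a ∈ s, a < b)
    [TopologicalSpace.SeparableSpace (I → Bool)] : HasCCC (gatedSpace R) := by
  intro 𝒰 h𝒰 hdisj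
  have hW : ∀ U ∈ 𝒰, ∃ W : Set (I → Bool), IsOpen W ∧ W.Nonempty ∧
      ∀ q (hq : ∀ γ, q ∈ R γ), (fun i => (q i).1) ∈ W →
        (⟨gate q, q, hq, rfl⟩ : gatedSpace R) ∈ U := by
    intro U hU
    obtain ⟨ho, ⟨_, p, hp, rfl⟩, hpU⟩ := h𝒰 U hU
    obtain ⟨V, hV, rfl⟩ := isOpen_induced_iff.1 ho
    exact hR.exists_isOpen hb (hV.preimage continuous_gate) hpU hp
  choose! W hWo hWne hW using hW
  refine Set.PairwiseDisjoint.countable_of_isOpen (s := W) ?_ hWo hWne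
  intro U hU U' hU' hne
  refine Set.disjoint_left.2 fun x hx hx' => ?_
  obtain ⟨q, hq, hqx⟩ := hR.exists_mem x
  obtain rfl : (fun i => (q i).1) = x := funext hqx
  exact Set.disjoint_left.1 (hdisj hU hU' hne) (hW U hU q hq hx) (hW U' hU' q hq hx')

end Gate

theorem separableSpace_cantorCube_omega_one :
    TopologicalSpace.SeparableSpace ((ω₁ : Ordinal.{0}).ToType → Bool) := by
  obtain ⟨j⟩ : Nonempty ((ω₁ : Ordinal.{0}).ToType ↪ (ℕ → Bool)) := by
    rw [← Cardinal.le_def, mk_toType_omega_one]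
    simpa using Cardinal.aleph_one_le_continuum
  exact separableSpace_cantorCube j j.injective

theorem Diamond.exists_valdiviaCompact (h : Diamond) :
    ∃ (K : Type) (_ : TopologicalSpace K), Nonempty K ∧ IsValdiviaCompact K ∧ topWeight K = ℵ₁ ∧
      HasCCC K ∧ ¬ HasGδPoint K ∧ ¬ HasSeqOutsideDenseSigma K := by
  obtain ⟨d, hd⟩ := h.exists_guess_seq
  have hc := countable_Iio_toType_omega_one
  have hb := exists_bound_of_countable_toType_omega_one
  obtain ⟨R, hR⟩ := exists_isConstraintFamily hc d
  have := separableSpace_cantorCube_omega_one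
  have hne : Nonempty (gatedSpace R) := by
    obtain ⟨q, hq, -⟩ := hR.exists_mem fun _ => false
    exact ⟨⟨gate q, q, hq, rfl⟩⟩
  have hcomp : CompactSpace (gatedSpace R) := isCompact_iff_compactSpace.1 hR.isCompact_gatedSpace
  have hS := isSigmaSubset_countable_support (gatedSpace R)
  have hSd := hR.dense_countable_support hc hb
  have hG := hR.not_hasGδPoint hb
  have hseq := hR.eventually_eq_of_tendsto_gatedSpace hc hb hd
  have hcard : #(Option (ω₁ : Ordinal.{0}).ToType × (ω₁ : Ordinal.{0}).ToType) = ℵ₁ := by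
    have hinf : ℵ₀ ≤ ℵ₁ := Cardinal.aleph0_le_aleph 1
    rw [Cardinal.mk_prod, Cardinal.mk_option, Cardinal.lift_id, Cardinal.lift_id,
      mk_toType_omega_one, Cardinal.add_one_eq hinf, Cardinal.mul_eq_self hinf]
  refine ⟨gatedSpace R, inferInstance, hne, ⟨hcomp, inferInstance, _, hS, hSd⟩,
    (topWeight_cubeSubspace_le hcard).antisymm (aleph_one_le_topWeight hG), hR.hasCCC hb, hG, ?_⟩
  rintro ⟨T, hT, hTd, s, x, -, hx, hlim, hnev⟩
  rw [hS.eq_of_dense hT hTd (fun x hx => hG ⟨x, hx.isGδ⟩) hseq] at hx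
  exact hnev (hseq s x hx hlim)

theorem theorem4p1 (hdiamond : Diamond) :
    (∃ (K : Type) (_ : TopologicalSpace K),
      IsValdiviaCompact K ∧
      topWeight K = ℵ₁ ∧
      HasCCC K ∧
      ¬ HasGδPoint K ∧
      ¬ HasSeqOutsideDenseSigma K) ∧
    ¬ ValdiviaConjecture := by
  obtain ⟨K, hK, hne, hV, hw, hccc, hG, hseq⟩ := hdiamond.exists_valdiviaCompact
  exact ⟨⟨K, hK, hV, hw, hccc, hG, hseq⟩, fun h => (h K hne hV hccc).elim hG hseq⟩
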